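/- Let $M$ be a connected $C^\infty$ manifold of dimension $n$ and let $F:TM\to[0,\infty)$ be a Finsler structure on it: $F$ is $C^\infty$ on the bundle $TM_0$ of non-zero tangent vectors, $F(x,\lambda y)=\lambda F(x,y)$ for all $\lambda>0$, and $g_{ij}(x,y)=\frac12\frac{\partial^2F^2}{\partial y^i\partial y^j}$ is positive definite on $TM_0$. Let $N^j_i=\frac{\partial G^j}{\partial y^i}$, where $G^j=\frac14 g^{jl}\bigl(y^k\frac{\partial^2F^2}{\partial x^k\partial y^l}-\frac{\partial F^2}{\partial x^l}\bigr)$, be the coefficients of the non-linear connection of the Cartan connection, and put $\delta y^j=dy^j+N^j_i\,dx^i$. Let $\alpha,\beta,\gamma$ be real numbers with $\alpha\gamma-\beta^2\neq0$, and let $\tilde g=\alpha g_1+\beta g_2+\gamma g_3$ be the lift metric on $TM_0$, where $$g_1=g_{ij}\,dx^i\otimes dx^j,\qquad g_2=g_{ij}\,(dx^i\otimes\delta y^j+\delta y^i\otimes dx^j),\qquad g_3=g_{ij}\,\delta y^i\otimes\delta y^j$$ (a Riemannian or pseudo-Riemannian metric). Let $V=v^i\frac{\partial}{\partial x^i}$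 be a $C^\infty$ vector field on $M$, let $X^c=v^i\frac{\partial}{\partial x^i}+y^j\frac{\partial v^i}{\partial x^j}\frac{\partial}{\partial y^i}$ be its complete lift, and suppose that $X^c$ is conformal for $\tilde g$, that is, $\mathcal L_{X^c}\tilde g=2\Omega\,\tilde g$ on $TM_0$ for some real function $\Omega$. Then, if $n\neq1$, $X^c$ is homothetic: $\Omega$ is constant on $TM_0$. In every dimension, including $n=1$, where $TM_0$ is disconnected, $\Omega$ is constant on each connected subset of $TM_0$. -/

import Mathlib

open scoped Manifold ContDiff

noncomputable section

namespace Finsler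

/-! ### Coordinate expressions

Natural coordinates `(x, y)` on the tangent bundle take values in `E × E`, where `E` is the model
space of the base manifold.  In this section `F : E × E → ℝ` is the coordinate expression of a
Finsler structure.  Index expressions are written as (multi)linear maps: `g_ij u^i w^j` is
`fundTensor F (x, y) u w`, and `N^j_i u^i` is `nonlinConn F (x, y) u`. -/

section Coordinates

variable {E : Type*} [NormedAddCommGroup E] [NormedSpace ℝ E]

/-- The fundamental tensor `g_ij = (1/2) ∂²F² / ∂y^i ∂y^j`. -/
def fundTensor (F : E × E → ℝ) (p : E × E) : E →L[ℝ] E →L[ℝ] ℝ :=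
  (1 / 2 : ℝ) • fderiv ℝ (fun y => fderiv ℝ (fun z => F (p.1, z) ^ 2) y) p.2

/-- The geodesic spray coefficients
`G^i = (1/4) g^{il} (y^k ∂²F² / ∂x^k ∂y^l - ∂F² / ∂x^l)`. -/
def sprayCoeff (F : E × E → ℝ) (p : E × E) : E :=
  (1 / 4 : ℝ) • (fundTensor F p).inverse
    (fderiv ℝ (fun x => fderiv ℝ (fun z => F (x, z) ^ 2) p.2) p.1 p.2
      - fderiv ℝ (fun x => F (x, p.2) ^ 2) p.1)

/-- The coefficients `N^j_i = ∂G^j / ∂y^i` of the non-linear connection of the Cartan connection. -/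
def nonlinConn (F : E × E → ℝ) (p : E × E) : E →L[ℝ] E :=
  fderiv ℝ (fun z => sprayCoeff F (p.1, z)) p.2

variable (E) in
/-- The vector-valued one-form `dx` on the coordinate domain of the tangent bundle. -/
def dx : (E × E) →L[ℝ] E := ContinuousLinearMap.fst ℝ E E

/-- The vector-valued one-form `δy^j = dy^j + N^j_i dx^i`, which vanishes on the horizontal
vectors `δ_i = ∂/∂x^i - N^j_i ∂/∂y^j`. -/
def deltaY (F : E × E → ℝ) (p : E × E) : (E × E) →L[ℝ] E :=
  ContinuousLinearMap.snd ℝ E E + (nonlinConn F p).comp (dx E)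

/-- `g₁ = g_ij dx^i ⊗ dx^j`. -/
def lift₁ (F : E × E → ℝ) (p : E × E) : (E × E) →L[ℝ] (E × E) →L[ℝ] ℝ :=
  (fundTensor F p).bilinearComp (dx E) (dx E)

/-- `g₂ = 2 g_ij dx^i δy^j`, the symmetric product, that is
`g_ij (dx^i ⊗ δy^j + δy^i ⊗ dx^j)`. -/
def lift₂ (F : E × E → ℝ) (p : E × E) : (E × E) →L[ℝ] (E × E) →L[ℝ] ℝ :=
  (fundTensor F p).bilinearComp (dx E) (deltaY F p)
    + (fundTensor F p).bilinearComp (deltaY F p) (dx E)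

/-- `g₃ = g_ij δy^i ⊗ δy^j`. -/
def lift₃ (F : E × E → ℝ) (p : E × E) : (E × E) →L[ℝ] (E × E) →L[ℝ] ℝ :=
  (fundTensor F p).bilinearComp (deltaY F p) (deltaY F p)

/-- The lift metric `α g₁ + β g₂ + γ g₃`. -/
def liftMetric (α β γ : ℝ) (F : E × E → ℝ) (p : E × E) : (E × E) →L[ℝ] (E × E) →L[ℝ] ℝ :=
  α • lift₁ F p + β • lift₂ F p + γ • lift₃ F p

/-- The complete lift `v^i ∂/∂x^i + y^j (∂v^i/∂x^j) ∂/∂y^i` of the vector field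
`v^i ∂/∂x^i`. -/
def completeLift (v : E → E) (p : E × E) : E × E :=
  (v p.1, fderiv ℝ v p.1 p.2)

/-- The Lie derivative along a vector field `X` of a covariant 2-tensor field `T`, in coordinates:
`X^c ∂_c T_ab + T_cb ∂_a X^c + T_ac ∂_b X^c`. -/
def lieDerivative {W : Type*} [NormedAddCommGroup W] [NormedSpace ℝ W]
    (X : W → W) (T : W → W →L[ℝ] W →L[ℝ] ℝ) (p : W) : W →L[ℝ] W →L[ℝ] ℝ :=
  fderiv ℝ T p (X p)
    + (T p).bilinearComp (fderiv ℝ X p) (ContinuousLinearMap.id ℝ W)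
    + (T p).bilinearComp (ContinuousLinearMap.id ℝ W) (fderiv ℝ X p)

end Coordinates

/-! ### Manifolds -/

section Manifold

variable {E : Type*} [NormedAddCommGroup E] [NormedSpace ℝ E]
  {M : Type*} [TopologicalSpace M] [ChartedSpace E M] [IsManifold 𝓘(ℝ, E) ∞ M]

/-- The natural coordinates `(x^i, y^i)` on the tangent bundle induced by the preferred chart of
`M` at `x₀`; they are defined on all tangent vectors based in the domain of that chart. -/
def natCoord (x₀ : M) : PartialEquiv (TangentBundle 𝓘(ℝ, E) M) (E × E) :=
  extChartAt (𝓘(ℝ, E)).tangent (⟨x₀, 0⟩ : TangentBundle 𝓘(ℝ, E) M)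

variable (E M) in
/-- The bundle `TM₀` of non-zero tangent vectors, as a subset of `TM`. -/
def slit : Set (TangentBundle 𝓘(ℝ, E) M) := {p | p.2 ≠ 0}

variable (E M) in
/-- A Finsler structure on the manifold `M`. -/
structure FinslerStructure where
  /-- The underlying function on the tangent bundle. -/
  toFun : TangentBundle 𝓘(ℝ, E) M → ℝ
  nonneg : ∀ p, 0 ≤ toFun p
  smooth : ContMDiffOn (𝓘(ℝ, E)).tangent 𝓘(ℝ, ℝ) ∞ toFun (slit E M)
  homogeneous : ∀ (x : M) (y : TangentSpace 𝓘(ℝ, E) x) (l : ℝ), 0 < l →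
    toFun ⟨x, l • y⟩ = l * toFun ⟨x, y⟩
  /-- The fundamental tensor is positive definite on `TM₀`, in all the natural coordinates. -/
  posDef : ∀ (x₀ : M), ∀ q ∈ (natCoord (E := E) x₀).target, q.2 ≠ 0 → ∀ w : E, w ≠ 0 →
    0 < fundTensor (fun r => toFun ((natCoord x₀).symm r)) q w w

/-- The expression of a Finsler structure in natural coordinates. -/
def FinslerStructure.inCoord (F : FinslerStructure E M) (x₀ : M) : E × E → ℝ :=
  fun q => F.toFun ((natCoord x₀).symm q)

/-- The components `v^i(x)` of a vector field on `M` in the preferred chart at `x₀`. -/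
def fieldInCoord (V : ∀ x : M, TangentSpace 𝓘(ℝ, E) x) (x₀ : M) : E → E :=
  fun x => (natCoord x₀ ⟨(extChartAt 𝓘(ℝ, E) x₀).symm x, V ((extChartAt 𝓘(ℝ, E) x₀).symm x)⟩).2

/-- The complete lift `X^c` of `V` satisfies `£_{X^c} g̃ = 2 Ω g̃` on `TM₀`, where
`g̃ = α g₁ + β g₂ + γ g₃` is the lift metric of the Finsler structure. -/
def IsConformalCompleteLift (F : FinslerStructure E M) (α β γ : ℝ)
    (V : ∀ x : M, TangentSpace 𝓘(ℝ, E) x) (Ω : TangentBundle 𝓘(ℝ, E) M → ℝ) : Prop :=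
  ∀ (x₀ : M), ∀ q ∈ (natCoord (E := E) x₀).target, q.2 ≠ 0 →
    lieDerivative (completeLift (fieldInCoord V x₀)) (liftMetric α β γ (F.inCoord x₀)) q
      = (2 * Ω ((natCoord x₀).symm q)) • liftMetric α β γ (F.inCoord x₀) q

end Manifold

end Finsler

end

/-! Write E = F² (`energy`), C for the Liouville field y^i ∂/∂y^i and S for the geodesic spray. By
homogeneity S is horizontal, so g̃ on the pairs (C, vertical), (S, vertical), (S, S) involves only E
and its vertical differential. Also [X^c, C] = 0, and [X^c, S] is vertical. The conformal equation
on these three kinds of pairs is therefore a small linear system, and αγ - β² ≠ 0 forces two facts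
(`conformal_components`): X^c rescales the vertical differential of E by 2Ω, and [X^c, S]
annihilates E.

The first fact and Euler's theorem give X^c E = 2ΩE. As E > 0, Ω is smooth, and differentiating
vertically shows that Ω depends locally on x only. Since SE = 0, the second fact gives 0 = [X^c, S]E
= -S(2ΩE) = -2E·SΩ, so y^i ∂Ω/∂x^i = 0. Differentiating this in y yields dΩ = 0
(`hasFDerivAt_conformalFactor`).

Hence Ω is locally constant on TM₀. For n ≥ 2 the punctured fibres are connected, and connectedness
of M makes Ω constant; for n = 0, TM₀ is empty. -/

noncomputable section

namespace Finsler

section Coordinates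

open ContinuousLinearMap Set Filter Topology VectorField

variable {E : Type*} [NormedAddCommGroup E] [NormedSpace ℝ E]

/-! ### Calculus on a product -/

section Calculus

variable {G W : Type*} [NormedAddCommGroup G] [NormedSpace ℝ G]
  [NormedAddCommGroup W] [NormedSpace ℝ W]

lemma fderiv_slice_right {f : E × E → G} {p : E × E} (hf : DifferentiableAt ℝ f p) :
    fderiv ℝ (fun z => f (p.1, z)) p.2 = (fderiv ℝ f p).comp (inr ℝ E E) :=
  (hf.hasFDerivAt.comp p.2 (hasFDerivAt_prodMk_right p.1 p.2)).fderiv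

lemma differentiableAt_slice_right {f : E × E → G} {p : E × E} (hf : DifferentiableAt ℝ f p) :
    DifferentiableAt ℝ (fun z => f (p.1, z)) p.2 :=
  (hf.hasFDerivAt.comp p.2 (hasFDerivAt_prodMk_right p.1 p.2)).differentiableAt

lemma fderiv_slice_left {f : E × E → G} {p : E × E} (hf : DifferentiableAt ℝ f p) :
    fderiv ℝ (fun x => f (x, p.2)) p.1 = (fderiv ℝ f p).comp (inl ℝ E E) :=
  (hf.hasFDerivAt.comp p.1 (hasFDerivAt_prodMk_left p.1 p.2)).fderiv

lemma fderiv_fun_const_smul_field (c : ℝ) (f : W → G) (x : W) :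
    fderiv ℝ (fun z => c • f z) x = c • fderiv ℝ f x :=
  congrFun (fderiv_const_smul_field (f := f) c) x

/-- Euler's theorem on homogeneous functions. -/
lemma fderiv_apply_self_of_homogeneous {f : E → G} {y : E} (hf : DifferentiableAt ℝ f y) (k : ℕ)
    (h : ∀ l : ℝ, 0 < l → f (l • y) = l ^ k • f y) : fderiv ℝ f y y = (k : ℝ) • f y := by
  have h1 : HasDerivAt (fun l : ℝ => f (l • y)) (fderiv ℝ f y y) 1 := by
    have hl : HasDerivAt (fun l : ℝ => l • y) y 1 := by
      simpa using (hasDerivAt_id (1 : ℝ)).smul_const y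
    have hf' : HasFDerivAt f (fderiv ℝ f y) ((1 : ℝ) • y) := by
      rw [one_smul]; exact hf.hasFDerivAt
    exact hf'.comp_hasDerivAt (1 : ℝ) hl
  have h2 : HasDerivAt (fun l : ℝ => l ^ k • f y) ((k : ℝ) • f y) 1 := by
    simpa using (hasDerivAt_pow k (1 : ℝ)).smul_const (f y)
  refine h1.unique (h2.congr_of_eventuallyEq ?_)
  filter_upwards [lt_mem_nhds (zero_lt_one' ℝ)] with l hl using h l hl

/-- The Leibniz rule for the Lie derivative of a covariant 2-tensor field. -/
lemma lieDerivative_apply {X A B : W → W} {T : W → W →L[ℝ] W →L[ℝ] ℝ} {p : W}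
    (hT : DifferentiableAt ℝ T p) (hA : DifferentiableAt ℝ A p) (hB : DifferentiableAt ℝ B p) :
    lieDerivative X T p (A p) (B p) = fderiv ℝ (fun q => T q (A q) (B q)) p (X p)
      - T p (lieBracket ℝ X A p) (B p) - T p (A p) (lieBracket ℝ X B p) := by
  rw [fderiv_clm_apply (hT.clm_apply hA) hB, fderiv_clm_apply hT hA]
  simp only [lieDerivative, lieBracket, add_apply, bilinearComp_apply, comp_apply, flip_apply,
    map_sub, sub_apply, coe_id', id]
  ring

end Calculus

/-! ### Finsler functions on a coordinate domain -/

/-- `F` is the coordinate expression of a Finsler structure over the open set `U`. -/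
structure IsFinslerOn (U : Set E) (F : E × E → ℝ) : Prop where
  isOpen : IsOpen U
  smooth : ContDiffOn ℝ ∞ F (U ×ˢ {0}ᶜ)
  homogeneous : ∀ x ∈ U, ∀ (y : E) (l : ℝ), 0 < l → F (x, l • y) = l * F (x, y)
  posDef : ∀ p ∈ U ×ˢ ({0}ᶜ : Set E), ∀ w : E, w ≠ 0 → 0 < fundTensor F p w w

/-- The square `F²` of a Finsler function. -/
def energy (F : E × E → ℝ) (p : E × E) : ℝ := F p ^ 2

variable {U : Set E} {F : E × E → ℝ} {p : E × E}

namespace IsFinslerOn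

lemma isOpen_prod (h : IsFinslerOn U F) : IsOpen (U ×ˢ ({0}ᶜ : Set E)) :=
  h.isOpen.prod isOpen_compl_singleton

lemma contDiffOn_energy (h : IsFinslerOn U F) : ContDiffOn ℝ ∞ (energy F) (U ×ˢ {0}ᶜ) :=
  h.smooth.pow 2

lemma contDiffOn_fderiv_energy (h : IsFinslerOn U F) :
    ContDiffOn ℝ ∞ (fderiv ℝ (energy F)) (U ×ˢ {0}ᶜ) :=
  h.contDiffOn_energy.fderiv_of_isOpen h.isOpen_prod le_rfl

lemma contDiffAt_energy (h : IsFinslerOn U F) (hp : p ∈ U ×ˢ ({0}ᶜ : Set E)) :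
    ContDiffAt ℝ ∞ (energy F) p :=
  h.contDiffOn_energy.contDiffAt (h.isOpen_prod.mem_nhds hp)

lemma differentiableAt_energy (h : IsFinslerOn U F) (hp : p ∈ U ×ˢ ({0}ᶜ : Set E)) :
    DifferentiableAt ℝ (energy F) p :=
  (h.contDiffAt_energy hp).differentiableAt (by simp)

lemma differentiableAt_fderiv_energy (h : IsFinslerOn U F) (hp : p ∈ U ×ˢ ({0}ᶜ : Set E)) :
    DifferentiableAt ℝ (fderiv ℝ (energy F)) p :=
  (h.contDiffOn_fderiv_energy.contDiffAt (h.isOpen_prod.mem_nhds hp)).differentiableAt (by simp)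

lemma isSymmSndFDerivAt_energy (h : IsFinslerOn U F) (hp : p ∈ U ×ˢ ({0}ᶜ : Set E)) :
    IsSymmSndFDerivAt ℝ (energy F) p :=
  (h.contDiffAt_energy hp).isSymmSndFDerivAt (by simpa using ENat.LEInfty.out)

lemma fderiv_energy_slice (h : IsFinslerOn U F) (hp : p ∈ U ×ˢ ({0}ᶜ : Set E)) :
    fderiv ℝ (fun z => F (p.1, z) ^ 2) p.2 = (fderiv ℝ (energy F) p).comp (inr ℝ E E) :=
  fderiv_slice_right (f := energy F) (h.differentiableAt_energy hp)

/-- Passing from iterated slice derivatives to a block of the total second derivative gives access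
to its symmetry and smoothness. -/
lemma fundTensor_eq (h : IsFinslerOn U F) (hp : p ∈ U ×ˢ ({0}ᶜ : Set E)) :
    fundTensor F p =
      (1 / 2 : ℝ) • (fderiv ℝ (fderiv ℝ (energy F)) p).bilinearComp (inr ℝ E E) (inr ℝ E E) := by
  have hev : (fun y => fderiv ℝ (fun z => F (p.1, z) ^ 2) y) =ᶠ[𝓝 p.2]
      fun y => (fderiv ℝ (energy F) (p.1, y)).comp (inr ℝ E E) := by
    filter_upwards [isOpen_compl_singleton.mem_nhds hp.2] with y hy
    exact h.fderiv_energy_slice (p := (p.1, y)) ⟨hp.1, hy⟩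
  have hd := h.differentiableAt_fderiv_energy hp
  rw [fundTensor, hev.fderiv_eq,
    fderiv_slice_right (f := fun q => (fderiv ℝ (energy F) q).comp (inr ℝ E E))
      (hd.clm_comp (differentiableAt_const _)),
    fderiv_clm_comp hd (differentiableAt_const _)]
  ext u w
  simp

lemma fundTensor_apply (h : IsFinslerOn U F) (hp : p ∈ U ×ˢ ({0}ᶜ : Set E)) (u w : E) :
    fundTensor F p u w = 1 / 2 * fderiv ℝ (fderiv ℝ (energy F)) p (0, u) (0, w) := by
  simp [h.fundTensor_eq hp]

lemma fundTensor_symm (h : IsFinslerOn U F) (hp : p ∈ U ×ˢ ({0}ᶜ : Set E)) (u w : E) :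
    fundTensor F p u w = fundTensor F p w u := by
  rw [h.fundTensor_apply hp, h.fundTensor_apply hp, (h.isSymmSndFDerivAt_energy hp).eq]

/-! Consequences of homogeneity. -/

lemma fderiv_energy_vertical_self (h : IsFinslerOn U F) (hp : p ∈ U ×ˢ ({0}ᶜ : Set E)) :
    fderiv ℝ (energy F) p (0, p.2) = 2 * energy F p := by
  have := fderiv_apply_self_of_homogeneous (f := fun z => energy F (p.1, z)) (y := p.2)
    (differentiableAt_slice_right (h.differentiableAt_energy hp)) 2
    (fun l hl => by simp [energy, h.homogeneous p.1 hp.1 p.2 l hl, mul_pow])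
  rw [fderiv_slice_right (h.differentiableAt_energy hp)] at this
  simpa using this

/-- Differentiate Euler's identity dE(0, y) = 2E along u; the last term comes from the variation of
y itself. -/
lemma fderiv_fderiv_energy_vertical_self (h : IsFinslerOn U F) (hp : p ∈ U ×ˢ ({0}ᶜ : Set E))
    (u : E × E) : fderiv ℝ (fderiv ℝ (energy F)) p u (0, p.2)
      = 2 * fderiv ℝ (energy F) p u - fderiv ℝ (energy F) p (0, u.2) := by
  have hev : (fun q : E × E => fderiv ℝ (energy F) q (0, q.2)) =ᶠ[𝓝 p]
      fun q => 2 * energy F q := by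
    filter_upwards [h.isOpen_prod.mem_nhds hp] with q hq using h.fderiv_energy_vertical_self hq
  have hC : HasFDerivAt (fun q : E × E => ((0 : E), q.2))
      ((0 : E × E →L[ℝ] E).prod (snd ℝ E E)) p := (hasFDerivAt_const _ _).prodMk hasFDerivAt_snd
  have h1 := (h.differentiableAt_fderiv_energy hp).hasFDerivAt.clm_apply hC
  have h2 := (h.differentiableAt_energy hp).hasFDerivAt.const_mul 2
  have h3 := congrArg (fun A => A u) (h1.unique (h2.congr_of_eventuallyEq hev))
  simp at h3
  linarith

/-- Through this identity, values of g̃ on C and S become derivatives of E. -/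
lemma fundTensor_self (h : IsFinslerOn U F) (hp : p ∈ U ×ˢ ({0}ᶜ : Set E)) (u : E) :
    fundTensor F p u p.2 = 1 / 2 * fderiv ℝ (energy F) p (0, u) := by
  rw [h.fundTensor_apply hp, h.fderiv_fderiv_energy_vertical_self hp]
  ring

lemma fundTensor_self_left (h : IsFinslerOn U F) (hp : p ∈ U ×ˢ ({0}ᶜ : Set E)) (u : E) :
    fundTensor F p p.2 u = 1 / 2 * fderiv ℝ (energy F) p (0, u) := by
  rw [h.fundTensor_symm hp, h.fundTensor_self hp]

lemma energy_pos (h : IsFinslerOn U F) (hp : p ∈ U ×ˢ ({0}ᶜ : Set E)) : 0 < energy F p := by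
  have := h.posDef p hp p.2 hp.2
  rw [h.fundTensor_self hp, h.fderiv_energy_vertical_self hp] at this
  linarith

lemma fderiv_energy_smul (h : IsFinslerOn U F) {x : E} (hx : x ∈ U) {l : ℝ} (hl : 0 < l) (y : E) :
    fderiv ℝ (fun z => F (x, z) ^ 2) (l • y) = l • fderiv ℝ (fun z => F (x, z) ^ 2) y := by
  have h1 : (fun z => F (x, l • z) ^ 2) = fun z => l ^ 2 • F (x, z) ^ 2 := by
    ext z; simp [h.homogeneous x hx z l hl, mul_pow]
  have h2 := fderiv_comp_smul (𝕜 := ℝ) (f := fun z => F (x, z) ^ 2) (x := y) l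
  rw [h1, fderiv_fun_const_smul_field, pow_two, mul_smul] at h2
  exact (smul_right_injective _ hl.ne' h2).symm

lemma fundTensor_smul (h : IsFinslerOn U F) {x : E} (hx : x ∈ U) {l : ℝ} (hl : 0 < l) (y : E) :
    fundTensor F (x, l • y) = fundTensor F (x, y) := by
  have h2 := fderiv_comp_smul (𝕜 := ℝ) (f := fderiv ℝ (fun z => F (x, z) ^ 2)) (x := y) l
  rw [funext (h.fderiv_energy_smul hx hl)] at h2
  simp only [fundTensor]
  exact congrArg _ (smul_right_injective _ hl.ne'
    ((fderiv_fun_const_smul_field l _ y).symm.trans h2)).symm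

/-- Degree count in y: g has degree 0, and both terms in the bracket defining G have degree 2. -/
lemma sprayCoeff_smul (h : IsFinslerOn U F) {x : E} (hx : x ∈ U) {l : ℝ} (hl : 0 < l) (y : E) :
    sprayCoeff F (x, l • y) = l ^ 2 • sprayCoeff F (x, y) := by
  have hU := h.isOpen.mem_nhds hx
  have e1 : (fun x' => fderiv ℝ (fun z => F (x', z) ^ 2) (l • y)) =ᶠ[𝓝 x]
      fun x' => l • fderiv ℝ (fun z => F (x', z) ^ 2) y := by
    filter_upwards [hU] with x' hx' using h.fderiv_energy_smul hx' hl y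
  have e2 : (fun x' => F (x', l • y) ^ 2) =ᶠ[𝓝 x] fun x' => l ^ 2 • F (x', y) ^ 2 := by
    filter_upwards [hU] with x' hx'
    simp [h.homogeneous x' hx' y l hl, mul_pow]
  simp only [sprayCoeff]
  rw [h.fundTensor_smul hx hl, e1.fderiv_eq, e2.fderiv_eq, fderiv_fun_const_smul_field,
    show fderiv ℝ (fun x' => l • fderiv ℝ (fun z => F (x', z) ^ 2) y) x = _ from
      fderiv_fun_const_smul_field l (fun x' => fderiv ℝ (fun z => F (x', z) ^ 2) y) x, smul_apply,
    map_smul, smul_smul, ← pow_two, ← smul_sub, map_smul,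
    smul_comm]

/-! The spray and the non-linear connection. -/

lemma sprayCoeff_eq (h : IsFinslerOn U F) (hp : p ∈ U ×ˢ ({0}ᶜ : Set E)) :
    sprayCoeff F p = (1 / 4 : ℝ) • (fundTensor F p).inverse
      ((fderiv ℝ (fderiv ℝ (energy F)) p (p.2, 0)).comp (inr ℝ E E)
        - (fderiv ℝ (energy F) p).comp (inl ℝ E E)) := by
  have hev : (fun x => fderiv ℝ (fun z => F (x, z) ^ 2) p.2) =ᶠ[𝓝 p.1]
      fun x => (fderiv ℝ (energy F) (x, p.2)).comp (inr ℝ E E) := by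
    filter_upwards [h.isOpen.mem_nhds hp.1] with x hx
    exact h.fderiv_energy_slice (p := (x, p.2)) ⟨hx, hp.2⟩
  have hd := h.differentiableAt_fderiv_energy hp
  rw [sprayCoeff, hev.fderiv_eq,
    fderiv_slice_left (f := fun q => (fderiv ℝ (energy F) q).comp (inr ℝ E E))
      (hd.clm_comp (differentiableAt_const _)),
    fderiv_clm_comp hd (differentiableAt_const _),
    show fderiv ℝ (fun x => F (x, p.2) ^ 2) p.1 = _ from
      fderiv_slice_left (f := energy F) (h.differentiableAt_energy hp)]
  congr 2
  ext u
  simp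

lemma contDiffOn_fundTensor (h : IsFinslerOn U F) :
    ContDiffOn ℝ ∞ (fundTensor F) (U ×ˢ {0}ᶜ) := by
  have hD := h.contDiffOn_fderiv_energy.fderiv_of_isOpen (m := ∞) h.isOpen_prod le_rfl
  refine ContDiffOn.congr (f := fun p => (1 / 2 : ℝ) •
    (((compL ℝ E (E × E) ℝ).flip (inr ℝ E E)).comp
      ((fderiv ℝ (fderiv ℝ (energy F)) p).comp (inr ℝ E E)))) ?_ ?_
  · exact (contDiffOn_const.clm_comp (hD.clm_comp contDiffOn_const)).const_smul _
  · intro p hp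
    rw [h.fundTensor_eq hp]
    ext u w
    simp

variable [FiniteDimensional ℝ E]

/-- Ensures that `inverse` in `sprayCoeff` is a true inverse and not its default value 0. -/
lemma isInvertible_fundTensor (h : IsFinslerOn U F) (hp : p ∈ U ×ˢ ({0}ᶜ : Set E)) :
    (fundTensor F p).IsInvertible := by
  have hinj : Function.Injective (fundTensor F p : E →ₗ[ℝ] (E →L[ℝ] ℝ)) := by
    rw [← LinearMap.ker_eq_bot, LinearMap.ker_eq_bot']
    intro w hw
    by_contra hne
    have := h.posDef p hp w hne
    rw [show fundTensor F p w = 0 from hw] at this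
    simp at this
  have hdim : Module.finrank ℝ E = Module.finrank ℝ (E →L[ℝ] ℝ) := by
    rw [← (LinearMap.toContinuousLinearMap (𝕜 := ℝ) (E := E) (F' := ℝ)).finrank_eq,
      Module.finrank_linearMap, Module.finrank_self, mul_one]
  exact ⟨(LinearEquiv.ofInjectiveOfFinrankEq _ hinj hdim).toContinuousLinearEquiv, by ext; rfl⟩

lemma contDiffOn_sprayCoeff (h : IsFinslerOn U F) :
    ContDiffOn ℝ ∞ (sprayCoeff F) (U ×ˢ {0}ᶜ) := by
  have : CompleteSpace E := FiniteDimensional.complete ℝ E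
  have hD := h.contDiffOn_fderiv_energy.fderiv_of_isOpen (m := ∞) h.isOpen_prod le_rfl
  have hinv : ContDiffOn ℝ ∞ (fun p => (fundTensor F p).inverse) (U ×ˢ {0}ᶜ) := fun p hp =>
    (h.isInvertible_fundTensor hp).contDiffAt_map_inverse.comp_contDiffWithinAt p
      (h.contDiffOn_fundTensor p hp)
  have hy : ContDiffOn ℝ ∞ (fun p : E × E => (p.2, (0 : E))) (U ×ˢ {0}ᶜ) :=
    (contDiff_snd.prodMk contDiff_const).contDiffOn
  refine ContDiffOn.congr ?_ fun p hp => h.sprayCoeff_eq hp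
  exact (hinv.clm_apply (((hD.clm_apply hy).clm_comp contDiffOn_const).sub
    (h.contDiffOn_fderiv_energy.clm_comp contDiffOn_const))).const_smul _

lemma differentiableAt_sprayCoeff (h : IsFinslerOn U F) (hp : p ∈ U ×ˢ ({0}ᶜ : Set E)) :
    DifferentiableAt ℝ (sprayCoeff F) p :=
  (h.contDiffOn_sprayCoeff.contDiffAt (h.isOpen_prod.mem_nhds hp)).differentiableAt (by simp)

lemma nonlinConn_eq (h : IsFinslerOn U F) (hp : p ∈ U ×ˢ ({0}ᶜ : Set E)) :
    nonlinConn F p = (fderiv ℝ (sprayCoeff F) p).comp (inr ℝ E E) :=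
  fderiv_slice_right (h.differentiableAt_sprayCoeff hp)

/-- Euler's theorem in degree 2; this is what makes the spray horizontal. -/
lemma nonlinConn_self (h : IsFinslerOn U F) (hp : p ∈ U ×ˢ ({0}ᶜ : Set E)) :
    nonlinConn F p p.2 = (2 : ℝ) • sprayCoeff F p := by
  have := fderiv_apply_self_of_homogeneous (f := fun z => sprayCoeff F (p.1, z)) (y := p.2)
    (differentiableAt_slice_right (h.differentiableAt_sprayCoeff hp)) 2
    (fun l hl => h.sprayCoeff_smul hp.1 hl p.2)
  exact_mod_cast this

/-- `F²` is constant along the geodesic spray. -/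
lemma fderiv_energy_spray (h : IsFinslerOn U F) (hp : p ∈ U ×ˢ ({0}ᶜ : Set E)) :
    fderiv ℝ (energy F) p (p.2, (-2 : ℝ) • sprayCoeff F p) = 0 := by
  -- Lower the index of G and contract with y: 4 g(G, y) = 2 dE(y, 0) - dE(y, 0), while g(G, y) = ½
  -- dE(0, G).
  have h1 := congrArg (fundTensor F p · p.2) (h.sprayCoeff_eq hp)
  simp only [map_smul, smul_apply] at h1
  have h2 := (h.isInvertible_fundTensor hp).self_comp_inverse
  have h3 := congrArg (fun A => A ((fderiv ℝ (fderiv ℝ (energy F)) p (p.2, 0)).comp (inr ℝ E E)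
        - (fderiv ℝ (energy F) p).comp (inl ℝ E E)) p.2) h2
  simp only [comp_apply, coe_id', id, sub_apply, inr_apply, inl_apply] at h3
  rw [h3, h.fundTensor_self hp, h.fderiv_fderiv_energy_vertical_self hp] at h1
  simp only [smul_eq_mul, Prod.mk_zero_zero, map_zero] at h1
  have h4 : ((p.2, (-2 : ℝ) • sprayCoeff F p) : E × E)
      = (p.2, 0) + (-2 : ℝ) • (0, sprayCoeff F p) := by simp
  rw [h4, map_add, map_smul, smul_eq_mul]
  linarith

lemma contDiffOn_liftMetric (h : IsFinslerOn U F) (α β γ : ℝ) :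
    ContDiffOn ℝ ∞ (liftMetric α β γ F) (U ×ˢ {0}ᶜ) := by
  have hg := h.contDiffOn_fundTensor
  have hN : ContDiffOn ℝ ∞ (nonlinConn F) (U ×ˢ {0}ᶜ) :=
    ((h.contDiffOn_sprayCoeff.fderiv_of_isOpen (m := ∞) h.isOpen_prod le_rfl).clm_comp
      contDiffOn_const).congr fun p hp => h.nonlinConn_eq hp
  have hδ : ContDiffOn ℝ ∞ (deltaY F) (U ×ˢ {0}ᶜ) :=
    contDiffOn_const.add (hN.clm_comp contDiffOn_const)
  have key : ∀ A B : E × E → (E × E →L[ℝ] E), ContDiffOn ℝ ∞ A (U ×ˢ {0}ᶜ) →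
      ContDiffOn ℝ ∞ B (U ×ˢ {0}ᶜ) →
      ContDiffOn ℝ ∞ (fun p => (fundTensor F p).bilinearComp (A p) (B p)) (U ×ˢ {0}ᶜ) := by
    intro A B hA hB
    -- `bilinearComp` is rewritten as a composition of linear maps, to which the smoothness rules
    -- apply.
    have : ContDiffOn ℝ ∞ (fun p => (((compL ℝ (E × E) E ℝ).flip (B p)).comp
      ((fundTensor F p).comp (A p)))) (U ×ˢ {0}ᶜ) :=
      (contDiffOn_const.clm_apply hB).clm_comp (hg.clm_comp hA)
    refine this.congr fun p _ => ?_
    ext <;> simp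
  have hx : ContDiffOn ℝ ∞ (fun _ : E × E => dx E) (U ×ˢ {0}ᶜ) := contDiffOn_const
  have h₁ := (key _ _ hx hx).const_smul α
  have h₂ := ((key _ _ hx hδ).add (key _ _ hδ hx)).const_smul β
  have h₃ := (key _ _ hδ hδ).const_smul γ
  exact (h₁.add h₂).add h₃

end IsFinslerOn

set_option synthInstance.maxHeartbeats 200000 in
lemma liftMetric_apply (α β γ : ℝ) (F : E × E → ℝ) (p a b : E × E) :
    liftMetric α β γ F p a b = α * fundTensor F p a.1 b.1
      + β * (fundTensor F p a.1 (deltaY F p b) + fundTensor F p (deltaY F p a) b.1)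
      + γ * fundTensor F p (deltaY F p a) (deltaY F p b) := by
  simp [liftMetric, lift₁, lift₂, lift₃, dx, mul_add]

lemma deltaY_apply (F : E × E → ℝ) (p a : E × E) :
    deltaY F p a = a.2 + nonlinConn F p a.1 := by
  simp [deltaY, dx]

end Coordinates

/-! ### Complete lifts, the geodesic spray and the conformal equation -/

section Coordinates

open ContinuousLinearMap Set Filter Topology VectorField

variable {E : Type*} [NormedAddCommGroup E] [NormedSpace ℝ E]
  {U : Set E} {F : E × E → ℝ} {v : E → E} {p : E × E} {α β γ : ℝ}

/-- The geodesic spray `y^i ∂/∂x^i - 2 G^i ∂/∂y^i`. -/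
def spray (F : E × E → ℝ) (p : E × E) : E × E := (p.2, (-2 : ℝ) • sprayCoeff F p)

lemma liftMetric_vertical_vertical (a b : E) :
    liftMetric α β γ F p (0, a) (0, b) = γ * fundTensor F p a b := by
  simp [liftMetric_apply, deltaY_apply]

lemma hasFDerivAt_completeLift (hU : IsOpen U) (hv : ContDiffOn ℝ ∞ v U) (hp : p.1 ∈ U) :
    HasFDerivAt (completeLift v) (((fderiv ℝ v p.1).comp (fst ℝ E E)).prod
      (((fderiv ℝ (fderiv ℝ v) p.1).comp (fst ℝ E E)).flip p.2
        + (fderiv ℝ v p.1).comp (snd ℝ E E))) p := by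
  have h1 : HasFDerivAt v (fderiv ℝ v p.1) p.1 :=
    ((hv.contDiffAt (hU.mem_nhds hp)).differentiableAt (by simp)).hasFDerivAt
  have h2 : HasFDerivAt (fderiv ℝ v) (fderiv ℝ (fderiv ℝ v) p.1) p.1 :=
    (((hv.fderiv_of_isOpen (m := ∞) hU le_rfl).contDiffAt (hU.mem_nhds hp)).differentiableAt
      (by simp)).hasFDerivAt
  have h3 := (h2.comp p hasFDerivAt_fst).clm_apply (hasFDerivAt_snd (p := p) (𝕜 := ℝ))
  rw [add_comm] at h3
  exact (h1.comp p hasFDerivAt_fst).prodMk h3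

lemma fderiv_completeLift (hU : IsOpen U) (hv : ContDiffOn ℝ ∞ v U) (hp : p.1 ∈ U) (a : E × E) :
    fderiv ℝ (completeLift v) p a =
      (fderiv ℝ v p.1 a.1, fderiv ℝ (fderiv ℝ v) p.1 a.1 p.2 + fderiv ℝ v p.1 a.2) := by
  rw [(hasFDerivAt_completeLift hU hv hp).fderiv]
  simp

lemma contDiffOn_completeLift (hU : IsOpen U) (hv : ContDiffOn ℝ ∞ v U) :
    ContDiffOn ℝ ∞ (completeLift v) (U ×ˢ {0}ᶜ) := by
  have hf : MapsTo Prod.fst (U ×ˢ ({0}ᶜ : Set E)) U := fun q hq => hq.1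
  exact (hv.comp contDiffOn_fst hf).prodMk
    (((hv.fderiv_of_isOpen (m := ∞) hU le_rfl).comp contDiffOn_fst hf).clm_apply contDiffOn_snd)

lemma lieBracket_completeLift_vertical (hU : IsOpen U) (hv : ContDiffOn ℝ ∞ v U) (hp : p.1 ∈ U)
    (u : E) : lieBracket ℝ (completeLift v) (fun _ => ((0 : E), u)) p
      = (0, - fderiv ℝ v p.1 u) := by
  simp [lieBracket, fderiv_completeLift hU hv hp]

/-- The complete lift is linear along the fibres, so its flow commutes with dilations. -/
lemma lieBracket_completeLift_liouville (hU : IsOpen U) (hv : ContDiffOn ℝ ∞ v U)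
    (hp : p.1 ∈ U) : lieBracket ℝ (completeLift v) (fun q => ((0 : E), q.2)) p = 0 := by
  have hC : HasFDerivAt (fun q : E × E => ((0 : E), q.2))
      ((0 : E × E →L[ℝ] E).prod (snd ℝ E E)) p := (hasFDerivAt_const _ _).prodMk hasFDerivAt_snd
  rw [lieBracket, hC.fderiv, fderiv_completeLift hU hv hp]
  simp [completeLift]

variable [FiniteDimensional ℝ E]

namespace IsFinslerOn

lemma deltaY_spray (h : IsFinslerOn U F) (hp : p ∈ U ×ˢ ({0}ᶜ : Set E)) :
    deltaY F p (spray F p) = 0 := by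
  simp [deltaY_apply, spray, h.nonlinConn_self hp]

lemma liftMetric_spray_vertical (h : IsFinslerOn U F) (hp : p ∈ U ×ˢ ({0}ᶜ : Set E)) (u : E) :
    liftMetric α β γ F p (spray F p) (0, u) = β * fundTensor F p p.2 u := by
  rw [liftMetric_apply, h.deltaY_spray hp]
  simp [deltaY_apply, spray]

lemma liftMetric_vertical_spray (h : IsFinslerOn U F) (hp : p ∈ U ×ˢ ({0}ᶜ : Set E)) (u : E) :
    liftMetric α β γ F p (0, u) (spray F p) = β * fundTensor F p u p.2 := by
  rw [liftMetric_apply, h.deltaY_spray hp]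
  simp [deltaY_apply, spray]

lemma liftMetric_spray_spray (h : IsFinslerOn U F) (hp : p ∈ U ×ˢ ({0}ᶜ : Set E)) :
    liftMetric α β γ F p (spray F p) (spray F p) = α * energy F p := by
  rw [liftMetric_apply, h.deltaY_spray hp]
  simp [spray, h.fundTensor_self hp, h.fderiv_energy_vertical_self hp]

lemma differentiableAt_spray (h : IsFinslerOn U F) (hp : p ∈ U ×ˢ ({0}ᶜ : Set E)) :
    DifferentiableAt ℝ (spray F) p :=
  differentiableAt_snd.prodMk ((h.differentiableAt_sprayCoeff hp).const_smul _)

lemma hasFDerivAt_spray (h : IsFinslerOn U F) (hp : p ∈ U ×ˢ ({0}ᶜ : Set E)) :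
    HasFDerivAt (spray F) ((snd ℝ E E).prod ((-2 : ℝ) • fderiv ℝ (sprayCoeff F) p)) p :=
  hasFDerivAt_snd.prodMk ((h.differentiableAt_sprayCoeff hp).hasFDerivAt.const_smul _)

/-- The bracket of a complete lift with the geodesic spray is vertical. -/
lemma lieBracket_completeLift_spray_fst (h : IsFinslerOn U F) (hv : ContDiffOn ℝ ∞ v U)
    (hp : p ∈ U ×ˢ ({0}ᶜ : Set E)) :
    (lieBracket ℝ (completeLift v) (spray F) p).1 = 0 := by
  -- Both terms of the bracket have first component Dv(y).
  rw [lieBracket, (h.hasFDerivAt_spray hp).fderiv, fderiv_completeLift h.isOpen hv hp.1]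
  simp [completeLift, spray]

/-- The conformal equation evaluated on the spray and on vertical vectors. -/
lemma conformal_components (h : IsFinslerOn U F) (hv : ContDiffOn ℝ ∞ v U)
    (hp : p ∈ U ×ˢ ({0}ᶜ : Set E)) (hαβγ : α * γ - β ^ 2 ≠ 0) {κ : ℝ}
    (hκ : lieDerivative (completeLift v) (liftMetric α β γ F) p
      = (2 * κ) • liftMetric α β γ F p) :
    (∀ u, fderiv ℝ (fderiv ℝ (energy F)) p (0, u) (completeLift v p)
        + fderiv ℝ (energy F) p (0, fderiv ℝ v p.1 u) = 2 * κ * fderiv ℝ (energy F) p (0, u)) ∧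
      fderiv ℝ (energy F) p (lieBracket ℝ (completeLift v) (spray F) p) = 0 := by
  obtain ⟨W, hW⟩ : ∃ W, lieBracket ℝ (completeLift v) (spray F) p = (0, W) :=
    ⟨_, Prod.ext (h.lieBracket_completeLift_spray_fst hv hp) rfl⟩
  have hT : DifferentiableAt ℝ (liftMetric α β γ F) p :=
    ((h.contDiffOn_liftMetric α β γ).contDiffAt (h.isOpen_prod.mem_nhds hp)).differentiableAt
      (by simp)
  have hS := h.differentiableAt_spray hp
  have hC : DifferentiableAt ℝ (fun q : E × E => ((0 : E), q.2)) p :=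
    (differentiableAt_const _).prodMk differentiableAt_snd
  have hK : ∀ u : E, DifferentiableAt ℝ (fun _ : E × E => ((0 : E), u)) p :=
    fun u => differentiableAt_const _
  have hD := h.differentiableAt_fderiv_energy hp
  have hmem := h.isOpen_prod.mem_nhds hp
  have hderiv : ∀ (c : ℝ) (u : E),
      fderiv ℝ (fun q => c * (1 / 2 * fderiv ℝ (energy F) q (0, u))) p (completeLift v p)
        = c * (1 / 2 * fderiv ℝ (fderiv ℝ (energy F)) p (0, u) (completeLift v p)) := by
    intro c u
    have := ((hD.hasFDerivAt.clm_apply (hK u).hasFDerivAt).const_mul (1 / 2 : ℝ)).const_mul c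
    rw [this.fderiv, (h.isSymmSndFDerivAt_energy hp).eq (0, u)]
    simp
  -- The defect X^c(dE(0, u)) - dE([X^c, (0, u)]) - 2κ dE(0, u), which is to vanish.
  set a : E → ℝ := fun u => fderiv ℝ (fderiv ℝ (energy F)) p (0, u) (completeLift v p)
        + fderiv ℝ (energy F) p (0, fderiv ℝ v p.1 u) - 2 * κ * fderiv ℝ (energy F) p (0, u)
    with ha
  -- The pair (C, (0, u)).
  have eqC : ∀ u, γ * a u = 0 := by
    intro u
    have e := lieDerivative_apply (X := completeLift v) hT hC (hK u)
    have hev : (fun q : E × E => liftMetric α β γ F q (0, q.2) (0, u)) =ᶠ[𝓝 p]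
        fun q => γ * (1 / 2 * fderiv ℝ (energy F) q (0, u)) := by
      filter_upwards [hmem] with q hq
      rw [liftMetric_vertical_vertical, h.fundTensor_self_left hq]
    rw [hκ, hev.fderiv_eq, lieBracket_completeLift_liouville h.isOpen hv hp.1,
      lieBracket_completeLift_vertical h.isOpen hv hp.1, hderiv, smul_apply, smul_apply,
      liftMetric_vertical_vertical, liftMetric_vertical_vertical, map_neg,
      h.fundTensor_self_left hp, h.fundTensor_self_left hp] at e
    simp only [map_zero, zero_apply, smul_eq_mul] at e
    simp only [ha]
    linarith
  -- The pair (S, (0, u)); W enters through [X^c, S].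
  have eqSV : ∀ u, β * a u = 2 * γ * fundTensor F p W u := by
    intro u
    have e := lieDerivative_apply (X := completeLift v) hT hS (hK u)
    have hev : (fun q : E × E => liftMetric α β γ F q (spray F q) (0, u)) =ᶠ[𝓝 p]
        fun q => β * (1 / 2 * fderiv ℝ (energy F) q (0, u)) := by
      filter_upwards [hmem] with q hq
      rw [h.liftMetric_spray_vertical hq, h.fundTensor_self_left hq]
    rw [hκ, hev.fderiv_eq, hW, lieBracket_completeLift_vertical h.isOpen hv hp.1, hderiv,
      smul_apply, smul_apply, liftMetric_vertical_vertical, h.liftMetric_spray_vertical hp,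
      h.liftMetric_spray_vertical hp, map_neg, h.fundTensor_self_left hp,
      h.fundTensor_self_left hp] at e
    simp only [smul_eq_mul] at e
    simp only [ha]
    linarith
  have hself : a p.2 = 2 * fderiv ℝ (energy F) p (completeLift v p) - 4 * κ * energy F p := by
    simp only [ha]
    rw [(h.isSymmSndFDerivAt_energy hp).eq, h.fderiv_fderiv_energy_vertical_self hp,
      h.fderiv_energy_vertical_self hp]
    simp only [completeLift]
    ring
  -- The pair (S, S).
  have eqSS : α * a p.2 = 2 * β * fderiv ℝ (energy F) p (0, W) := by
    have e := lieDerivative_apply (X := completeLift v) hT hS hS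
    have hev : (fun q : E × E => liftMetric α β γ F q (spray F q) (spray F q)) =ᶠ[𝓝 p]
        fun q => α * energy F q := by
      filter_upwards [hmem] with q hq using h.liftMetric_spray_spray hq
    rw [hκ, hev.fderiv_eq, hW, fderiv_const_mul (h.differentiableAt_energy hp), smul_apply,
      smul_apply, h.liftMetric_spray_spray hp, h.liftMetric_spray_vertical hp,
      h.liftMetric_vertical_spray hp, h.fundTensor_self_left hp, h.fundTensor_self hp] at e
    simp only [smul_eq_mul, smul_apply] at e
    rw [hself]
    linarith
  have eqW : β * a p.2 = γ * fderiv ℝ (energy F) p (0, W) := by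
    rw [eqSV, h.fundTensor_self hp]
    ring
  have main : (∀ u, a u = 0) ∧ fderiv ℝ (energy F) p (0, W) = 0 := by
    -- If γ = 0, then β ≠ 0: `eqSV` kills a and `eqSS` gives dE(0, W) = 0. Otherwise `eqC` kills a
    -- and `eqW` does the rest.
    by_cases hγ : γ = 0
    · have hβ : β ≠ 0 := by rintro rfl; simp [hγ] at hαβγ
      have ha0 : ∀ u, a u = 0 := fun u => by simpa [hγ, hβ] using eqSV u
      refine ⟨ha0, ?_⟩
      rw [ha0] at eqSS
      simpa [hβ] using eqSS.symm
    · have ha0 : ∀ u, a u = 0 := fun u => by simpa [hγ] using eqC u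
      refine ⟨ha0, ?_⟩
      rw [ha0] at eqW
      simpa [hγ] using eqW.symm
  refine ⟨fun u => ?_, hW ▸ main.2⟩
  have := main.1 u
  simp only [ha] at this
  linarith

/-- If the complete lift of a vector field is conformal for the lift metric, then the conformal
factor has vanishing derivative. -/
theorem hasFDerivAt_conformalFactor (h : IsFinslerOn U F) (hv : ContDiffOn ℝ ∞ v U)
    (hαβγ : α * γ - β ^ 2 ≠ 0) {κ : E × E → ℝ}
    (hκ : ∀ q ∈ U ×ˢ ({0}ᶜ : Set E), lieDerivative (completeLift v) (liftMetric α β γ F) q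
      = (2 * κ q) • liftMetric α β γ F q) (hp : p ∈ U ×ˢ ({0}ᶜ : Set E)) :
    HasFDerivAt κ (0 : E × E →L[ℝ] ℝ) p := by
  have hX := contDiffOn_completeLift h.isOpen hv
  have hXd : ∀ q ∈ U ×ˢ ({0}ᶜ : Set E), DifferentiableAt ℝ (completeLift v) q := fun q hq =>
    (hasFDerivAt_completeLift h.isOpen hv hq.1).differentiableAt
  -- the derivative of the energy along the complete lift
  have hΦ : ContDiffOn ℝ ∞ (fun q => fderiv ℝ (energy F) q (completeLift v q)) (U ×ˢ {0}ᶜ) :=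
    h.contDiffOn_fderiv_energy.clm_apply hX
  have hΦeq : ∀ q ∈ U ×ˢ ({0}ᶜ : Set E),
      fderiv ℝ (energy F) q (completeLift v q) = 2 * κ q * energy F q := by
    intro q hq
    have := (h.conformal_components hv hq hαβγ (hκ q hq)).1 q.2
    rw [(h.isSymmSndFDerivAt_energy hq).eq, h.fderiv_fderiv_energy_vertical_self hq,
      h.fderiv_energy_vertical_self hq] at this
    simp only [completeLift] at this ⊢
    linarith
  -- No regularity of κ is assumed; it is recovered as the quotient X^c E / (2E).
  have hκs : ContDiffOn ℝ ∞ κ (U ×ˢ {0}ᶜ) := by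
    refine (hΦ.div (contDiffOn_const.mul h.contDiffOn_energy) fun q hq => ?_).congr
      (f₁ := κ) (f := fun q => fderiv ℝ (energy F) q (completeLift v q) / (2 * energy F q))
      fun q hq => ?_
    · exact mul_ne_zero two_ne_zero (h.energy_pos hq).ne'
    · rw [hΦeq q hq]
      have := (h.energy_pos hq).ne'
      field_simp
  have hκd : ∀ q ∈ U ×ˢ ({0}ᶜ : Set E), DifferentiableAt ℝ κ q := fun q hq =>
    (hκs.contDiffAt (h.isOpen_prod.mem_nhds hq)).differentiableAt (by simp)
  have hDΦ : ∀ q ∈ U ×ˢ ({0}ᶜ : Set E), ∀ a,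
      fderiv ℝ (fun q => fderiv ℝ (energy F) q (completeLift v q)) q a
        = 2 * κ q * fderiv ℝ (energy F) q a + 2 * energy F q * fderiv ℝ κ q a := by
    intro q hq a
    have hev : (fun q => fderiv ℝ (energy F) q (completeLift v q)) =ᶠ[𝓝 q]
        fun q => 2 * κ q * energy F q := by
      filter_upwards [h.isOpen_prod.mem_nhds hq] with r hr using hΦeq r hr
    have hmul := ((hκd q hq).hasFDerivAt.const_mul 2).fun_mul
      (h.differentiableAt_energy hq).hasFDerivAt
    rw [hev.fderiv_eq, hmul.fderiv]
    simp
    ring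
  -- The vertical derivative of X^c E = 2κE is compared with the first conformal identity; only 2E
  -- ∂κ survives.
  have hvert : ∀ q ∈ U ×ˢ ({0}ᶜ : Set E), ∀ u, fderiv ℝ κ q (0, u) = 0 := by
    intro q hq u
    have h1 := hDΦ q hq (0, u)
    rw [fderiv_clm_apply (h.differentiableAt_fderiv_energy hq) (hXd q hq)] at h1
    simp only [add_apply, comp_apply, flip_apply, fderiv_completeLift h.isOpen hv hq.1,
      map_zero, zero_apply, zero_add] at h1
    have h2 := (h.conformal_components hv hq hαβγ (hκ q hq)).1 u
    have h3 := (h.energy_pos hq).ne'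
    have h4 : 2 * energy F q * fderiv ℝ κ q (0, u) = 0 := by linarith
    simpa [h3] using h4
  have hspray : ∀ q ∈ U ×ˢ ({0}ᶜ : Set E), fderiv ℝ κ q (spray F q) = 0 := by
    intro q hq
    have h1 := fderiv_apply_lieBracket (h.contDiffAt_energy hq) (by simpa using ENat.LEInfty.out)
      (h.differentiableAt_spray hq) (hXd q hq)
    have hev : (fun q => fderiv ℝ (energy F) q (spray F q)) =ᶠ[𝓝 q] fun _ => 0 := by
      filter_upwards [h.isOpen_prod.mem_nhds hq] with r hr using h.fderiv_energy_spray hr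
    rw [(h.conformal_components hv hq hαβγ (hκ q hq)).2, hev.fderiv_eq, hDΦ q hq,
      show fderiv ℝ (energy F) q (spray F q) = 0 from h.fderiv_energy_spray hq] at h1
    have h3 := (h.energy_pos hq).ne'
    simpa [h3] using h1
  have hhor : ∀ q ∈ U ×ˢ ({0}ᶜ : Set E), fderiv ℝ κ q (q.2, 0) = 0 := by
    intro q hq
    have h1 : spray F q = (q.2, 0) + (0, (-2 : ℝ) • sprayCoeff F q) := by simp [spray]
    have h2 := hspray q hq
    rwa [h1, map_add, hvert q hq, add_zero] at h2
  have hDκ : DifferentiableAt ℝ (fderiv ℝ κ) p :=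
    ((hκs.fderiv_of_isOpen (m := ∞) h.isOpen_prod le_rfl).contDiffAt
      (h.isOpen_prod.mem_nhds hp)).differentiableAt (by simp)
  have hzero : fderiv ℝ κ p = 0 := by
    -- The derivative of dκ(y, 0) = 0 along (0, u) is D²κ((0, u), (y, 0)) + dκ(u, 0) = 0. The mixed
    -- term vanishes by symmetry, since dκ(0, u) = 0 near p.
    have hu : ∀ u : E, fderiv ℝ κ p (u, 0) = 0 := by
      intro u
      have hB : HasFDerivAt (fun q : E × E => (q.2, (0 : E)))
        ((snd ℝ E E).prod (0 : E × E →L[ℝ] E)) p := hasFDerivAt_snd.prodMk (hasFDerivAt_const _ _)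
      have hev : (fun q : E × E => fderiv ℝ κ q (q.2, 0)) =ᶠ[𝓝 p] fun _ => 0 := by
        filter_upwards [h.isOpen_prod.mem_nhds hp] with r hr using hhor r hr
      have hev' : (fun q : E × E => fderiv ℝ κ q (0, u)) =ᶠ[𝓝 p] fun _ => 0 := by
        filter_upwards [h.isOpen_prod.mem_nhds hp] with r hr using hvert r hr u
      have e1 := congrArg (fun A => A (0, u)) ((hDκ.hasFDerivAt.clm_apply hB).unique
        ((hasFDerivAt_const (0 : ℝ) p).congr_of_eventuallyEq hev))
      have e2 := congrArg (fun A => A (p.2, 0))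
        ((hDκ.hasFDerivAt.clm_apply (hasFDerivAt_const ((0 : E), u) p)).unique
          ((hasFDerivAt_const (0 : ℝ) p).congr_of_eventuallyEq hev'))
      have hsymm : IsSymmSndFDerivAt ℝ κ p :=
        (hκs.contDiffAt (h.isOpen_prod.mem_nhds hp)).isSymmSndFDerivAt
          (by simpa using ENat.LEInfty.out)
      simp at e1 e2
      rw [hsymm.eq, e2] at e1
      simpa using e1
    ext u
    · simpa using hu u
    · simpa using hvert p hp u
  exact hzero ▸ (hκd p hp).hasFDerivAt

end IsFinslerOn

end Coordinates

/-! ### From coordinate domains to TM₀ -/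

section Manifold

open Set Filter Topology Bundle

variable {E : Type*} [NormedAddCommGroup E] [NormedSpace ℝ E]
  {M : Type*} [TopologicalSpace M] [ChartedSpace E M] [IsManifold 𝓘(ℝ, E) ∞ M]

/-! ### Natural coordinates -/

lemma natCoord_eq (x₀ : M) : natCoord x₀ =
    (trivializationAt E (TangentSpace 𝓘(ℝ, E)) x₀).toPartialEquiv ≫
      (extChartAt 𝓘(ℝ, E) x₀).prod (PartialEquiv.refl E) :=
  FiberBundle.extChartAt (IB := 𝓘(ℝ, E)) (⟨x₀, 0⟩ : TangentBundle 𝓘(ℝ, E) M)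

lemma mem_natCoord_source {x₀ : M} {p : TangentBundle 𝓘(ℝ, E) M} :
    p ∈ (natCoord x₀).source ↔ p.proj ∈ (chartAt E x₀).source := by
  rw [natCoord, extChartAt_source]
  exact TangentBundle.mem_chart_source_iff p ⟨x₀, 0⟩

lemma natCoord_apply_fst (x₀ : M) (p : TangentBundle 𝓘(ℝ, E) M) :
    (natCoord x₀ p).1 = extChartAt 𝓘(ℝ, E) x₀ p.proj := by
  rw [natCoord_eq]
  rfl

lemma natCoord_target (x₀ : M) :
    (natCoord x₀).target = (extChartAt 𝓘(ℝ, E) x₀).target ×ˢ (univ : Set E) := by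
  have h := FiberBundle.extChartAt_target (IB := 𝓘(ℝ, E)) (⟨x₀, 0⟩ : TangentBundle 𝓘(ℝ, E) M)
  refine h.trans ?_
  congr 1
  refine inter_eq_left.2 fun x hx => ?_
  have := (extChartAt 𝓘(ℝ, E) x₀).map_target hx
  rw [extChartAt_source] at this
  exact this

/-- Linearity on fibres transfers homogeneity and non-vanishing between TM and coordinates. -/
lemma exists_natCoord_symm_eq {x₀ : M} {x : E} (hx : x ∈ (extChartAt 𝓘(ℝ, E) x₀).target) :
    ∃ A : E ≃L[ℝ] TangentSpace 𝓘(ℝ, E) ((extChartAt 𝓘(ℝ, E) x₀).symm x),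
      ∀ y, (natCoord x₀).symm (x, y) = ⟨(extChartAt 𝓘(ℝ, E) x₀).symm x, A y⟩ := by
  have hb : (extChartAt 𝓘(ℝ, E) x₀).symm x ∈
      (trivializationAt E (TangentSpace 𝓘(ℝ, E)) x₀).baseSet := by
    have := (extChartAt 𝓘(ℝ, E) x₀).map_target hx
    rw [extChartAt_source] at this
    exact this
  refine ⟨((trivializationAt E (TangentSpace 𝓘(ℝ, E)) x₀).continuousLinearEquivAt ℝ _ hb).symm,
    fun y => ?_⟩
  rw [natCoord_eq]
  exact ((trivializationAt E (TangentSpace 𝓘(ℝ, E)) x₀).mk_symm hb y).symm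

lemma natCoord_symm_mem_slit {x₀ : M} {q : E × E} (hq : q ∈ (natCoord (E := E) x₀).target) :
    (natCoord x₀).symm q ∈ slit E M ↔ q.2 ≠ 0 := by
  rw [natCoord_target] at hq
  obtain ⟨A, hA⟩ := exists_natCoord_symm_eq hq.1
  rw [show q = (q.1, q.2) from rfl, hA]
  exact A.toLinearEquiv.map_ne_zero_iff

lemma contMDiffOn_natCoord_symm (x₀ : M) :
    ContMDiffOn 𝓘(ℝ, E × E) (𝓘(ℝ, E)).tangent ∞ (natCoord (E := E) x₀).symm
      (natCoord (E := E) x₀).target :=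
  contMDiffOn_extChartAt_symm _

/-- The coordinate expression of a Finsler structure. -/
lemma FinslerStructure.isFinslerOn_inCoord (F : FinslerStructure E M) (x₀ : M) :
    IsFinslerOn (extChartAt 𝓘(ℝ, E) x₀).target (F.inCoord x₀) where
  isOpen := isOpen_extChartAt_target x₀
  smooth := by
    rw [← contMDiffOn_iff_contDiffOn]
    have hsub : (extChartAt 𝓘(ℝ, E) x₀).target ×ˢ ({0}ᶜ : Set E) ⊆ (natCoord (E := E) x₀).target := by
      rw [natCoord_target]
      exact prod_mono_right (subset_univ _)
    exact F.smooth.comp ((contMDiffOn_natCoord_symm x₀).mono hsub) fun q hq =>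
      (natCoord_symm_mem_slit (hsub hq)).2 hq.2
  homogeneous := by
    intro x hx y l hl
    obtain ⟨A, hA⟩ := exists_natCoord_symm_eq hx
    simp only [inCoord, hA, map_smul]
    exact F.homogeneous _ _ l hl
  posDef := fun p hp w hw => F.posDef x₀ p (by rw [natCoord_target]; exact ⟨hp.1, mem_univ _⟩)
    hp.2 w hw

lemma contDiffOn_fieldInCoord {V : ∀ x : M, TangentSpace 𝓘(ℝ, E) x}
    (hV : ContMDiff 𝓘(ℝ, E) (𝓘(ℝ, E)).tangent ∞
      (fun x => (⟨x, V x⟩ : TangentBundle 𝓘(ℝ, E) M))) (x₀ : M) :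
    ContDiffOn ℝ ∞ (fieldInCoord V x₀) (extChartAt 𝓘(ℝ, E) x₀).target := by
  rw [← contMDiffOn_iff_contDiffOn]
  have h1 : ContMDiffOn (𝓘(ℝ, E)).tangent 𝓘(ℝ, E × E) ∞ (natCoord (E := E) x₀)
      (natCoord (E := E) x₀).source := by
    have := contMDiffOn_extChartAt (I := (𝓘(ℝ, E)).tangent) (n := ∞)
      (x := (⟨x₀, 0⟩ : TangentBundle 𝓘(ℝ, E) M))
    rwa [← extChartAt_source (𝓘(ℝ, E)).tangent] at this
  have h2 := hV.comp_contMDiffOn (contMDiffOn_extChartAt_symm (I := 𝓘(ℝ, E)) (n := ∞) x₀)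
  have h3 : ContMDiffOn 𝓘(ℝ, E) 𝓘(ℝ, E × E) ∞ (fun x => natCoord x₀
      ⟨(extChartAt 𝓘(ℝ, E) x₀).symm x, V ((extChartAt 𝓘(ℝ, E) x₀).symm x)⟩)
      (extChartAt 𝓘(ℝ, E) x₀).target := by
    refine h1.comp h2 fun x hx => ?_
    have := (extChartAt 𝓘(ℝ, E) x₀).map_target hx
    rw [extChartAt_source] at this
    exact mem_natCoord_source.2 this
  exact (contDiff_snd.contMDiff (n := ∞)).comp_contMDiffOn h3

/-! ### Locally constant functions on `TM₀` -/

variable {Ω : TangentBundle 𝓘(ℝ, E) M → ℝ}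

lemma exists_eq_const_of_isPreconnected (hloc : ∀ p ∈ slit E M, ∀ᶠ q in 𝓝 p, Ω q = Ω p)
    {S : Set (TangentBundle 𝓘(ℝ, E) M)} (hS : S ⊆ slit E M) (hc : IsPreconnected S) :
    ∃ c : ℝ, ∀ p ∈ S, Ω p = c := by
  rcases S.eq_empty_or_nonempty with rfl | ⟨p₀, hp₀⟩
  · exact ⟨0, by simp⟩
  have : PreconnectedSpace S := isPreconnected_iff_preconnectedSpace.1 hc
  have hl : IsLocallyConstant fun s : S => Ω s :=
    (IsLocallyConstant.iff_eventually_eq _).2 fun s =>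
      continuous_subtype_val.continuousAt.eventually (hloc s (hS s.2))
  exact ⟨Ω p₀, fun p hp => hl.apply_eq_of_preconnectedSpace ⟨p, hp⟩ ⟨p₀, hp₀⟩⟩

lemma continuousOn_natCoord_symm (x₀ : M) :
    ContinuousOn (natCoord (E := E) x₀).symm (natCoord (E := E) x₀).target :=
  continuousOn_extChartAt_symm _

/-- In dimension at least two, a locally constant function on `TM₀` is constant on the fibres. -/
lemma eq_of_proj_eq (hdim : 1 < Module.rank ℝ E)
    (hloc : ∀ p ∈ slit E M, ∀ᶠ q in 𝓝 p, Ω q = Ω p) {p q : TangentBundle 𝓘(ℝ, E) M}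
    (hp : p ∈ slit E M) (hq : q ∈ slit E M) (hpq : p.proj = q.proj) : Ω p = Ω q := by
  set x₀ : M := p.proj
  have hmap : ∀ y : E, (extChartAt 𝓘(ℝ, E) x₀ x₀, y) ∈ (natCoord (E := E) x₀).target := fun y => by
    rw [natCoord_target]
    exact ⟨mem_extChartAt_target x₀, mem_univ _⟩
  -- The punctured fibre is the image of E minus the origin, connected because the rank exceeds one.
  have hconn : IsPreconnected
      ((fun y : E => (natCoord x₀).symm (extChartAt 𝓘(ℝ, E) x₀ x₀, y)) '' {0}ᶜ) :=
    (isConnected_compl_singleton_of_one_lt_rank hdim (0 : E)).isPreconnected.image _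
      ((continuousOn_natCoord_symm x₀).comp (by fun_prop) fun y _ => hmap y)
  obtain ⟨c, hc⟩ := exists_eq_const_of_isPreconnected hloc
    (image_subset_iff.2 fun y hy => (natCoord_symm_mem_slit (hmap y)).2 hy) hconn
  have key : ∀ r ∈ slit E M, r.proj = x₀ → Ω r = c := by
    intro r hr hrx
    have hrs : r ∈ (natCoord x₀).source :=
      mem_natCoord_source.2 (by rw [hrx]; exact mem_chart_source E x₀)
    have h1 : natCoord x₀ r = (extChartAt 𝓘(ℝ, E) x₀ x₀, (natCoord x₀ r).2) :=
      Prod.ext (by rw [natCoord_apply_fst, hrx]) rfl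
    refine hc r ⟨(natCoord x₀ r).2, ?_, ?_⟩
    · refine (natCoord_symm_mem_slit ((natCoord x₀).map_source hrs)).1 ?_
      rwa [(natCoord x₀).left_inv hrs]
    · change (natCoord x₀).symm (extChartAt 𝓘(ℝ, E) x₀ x₀, (natCoord x₀ r).2) = r
      rw [← h1, (natCoord x₀).left_inv hrs]
  rw [key p hp rfl, key q hq hpq.symm]

/-- In dimension at least two, a locally constant function on `TM₀` is constant if `M` is
connected. -/
theorem exists_eq_const_of_one_lt_rank [PreconnectedSpace M] (hdim : 1 < Module.rank ℝ E)
    (hloc : ∀ p ∈ slit E M, ∀ᶠ q in 𝓝 p, Ω q = Ω p) : ∃ c : ℝ, ∀ p ∈ slit E M, Ω p = c := by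
  have : Nontrivial E := rank_pos_iff_nontrivial.1 (zero_lt_one.trans hdim)
  obtain ⟨e, he⟩ := exists_ne (0 : E)
  have hmem : ∀ x₀ : M, ∀ x ∈ (extChartAt 𝓘(ℝ, E) x₀).source,
      (extChartAt 𝓘(ℝ, E) x₀ x, e) ∈ (natCoord (E := E) x₀).target := fun x₀ x hx => by
    rw [natCoord_target]
    exact ⟨(extChartAt 𝓘(ℝ, E) x₀).map_source hx, mem_univ _⟩
  -- σ x₀ is the local non-vanishing section with constant component e in the chart at x₀.
  let σ : M → M → TangentBundle 𝓘(ℝ, E) M := fun x₀ x =>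
    (natCoord x₀).symm (extChartAt 𝓘(ℝ, E) x₀ x, e)
  have hσ : ∀ x₀ : M, ∀ x ∈ (extChartAt 𝓘(ℝ, E) x₀).source,
      σ x₀ x ∈ slit E M ∧ (σ x₀ x).proj = x := by
    intro x₀ x hx
    refine ⟨(natCoord_symm_mem_slit (hmem x₀ x hx)).2 he, ?_⟩
    obtain ⟨A, hA⟩ := exists_natCoord_symm_eq ((extChartAt 𝓘(ℝ, E) x₀).map_source hx)
    simp only [σ, hA]
    exact (extChartAt 𝓘(ℝ, E) x₀).left_inv hx
  -- The preferred chart may jump with x, so x ↦ σ x x need not be continuous; but Ω depends only on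
  -- the base point, so near x₀ the section σ x₀ may replace it.
  have hl : IsLocallyConstant fun x : M => Ω (σ x x) := by
    refine (IsLocallyConstant.iff_eventually_eq _).2 fun x₀ => ?_
    have hx₀ := mem_extChartAt_source (I := 𝓘(ℝ, E)) x₀
    have hcont : ContinuousAt (σ x₀) x₀ := by
      have h1 : ContinuousAt (natCoord (E := E) x₀).symm (extChartAt 𝓘(ℝ, E) x₀ x₀, e) :=
        continuousAt_extChartAt_symm'' (hmem x₀ x₀ hx₀)
      exact h1.comp (f := fun x => (extChartAt 𝓘(ℝ, E) x₀ x, e))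
        ((continuousAt_extChartAt x₀).prodMk continuousAt_const)
    filter_upwards [hcont.eventually (hloc _ (hσ x₀ x₀ hx₀).1),
      extChartAt_source_mem_nhds (I := 𝓘(ℝ, E)) x₀] with x hx hxs
    have h2 := hσ x x (mem_extChartAt_source x)
    rw [← hx]
    exact eq_of_proj_eq hdim hloc h2.1 (hσ x₀ x hxs).1 (h2.2.trans (hσ x₀ x hxs).2.symm)
  rcases isEmpty_or_nonempty M with hM | ⟨⟨m⟩⟩
  · exact ⟨0, fun p _ => (hM.false p.proj).elim⟩
  refine ⟨Ω (σ m m), fun p hp => ?_⟩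
  rw [← hl.apply_eq_of_preconnectedSpace p.proj m]
  have h2 := hσ p.proj p.proj (mem_extChartAt_source _)
  exact eq_of_proj_eq hdim hloc hp h2.1 h2.2.symm

/-! ### Conformal factors -/

variable [FiniteDimensional ℝ E]

/-- The conformal factor of a conformal complete lift is locally constant on `TM₀`. -/
theorem IsConformalCompleteLift.eventually_eq {F : FinslerStructure E M} {α β γ : ℝ}
    (hαβγ : α * γ - β ^ 2 ≠ 0) {V : ∀ x : M, TangentSpace 𝓘(ℝ, E) x}
    (hV : ContMDiff 𝓘(ℝ, E) (𝓘(ℝ, E)).tangent ∞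
      (fun x => (⟨x, V x⟩ : TangentBundle 𝓘(ℝ, E) M)))
    {Ω : TangentBundle 𝓘(ℝ, E) M → ℝ} (hΩ : IsConformalCompleteLift F α β γ V Ω)
    {p : TangentBundle 𝓘(ℝ, E) M} (hp : p ∈ slit E M) : ∀ᶠ q in 𝓝 p, Ω q = Ω p := by
  set x₀ : M := p.proj
  have hF := F.isFinslerOn_inCoord x₀
  set κ : E × E → ℝ := fun q => Ω ((natCoord x₀).symm q)
  have hκ : ∀ q ∈ (extChartAt 𝓘(ℝ, E) x₀).target ×ˢ ({0}ᶜ : Set E),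
      HasFDerivAt κ (0 : E × E →L[ℝ] ℝ) q := fun q hq =>
    hF.hasFDerivAt_conformalFactor (contDiffOn_fieldInCoord hV x₀) hαβγ
      (fun r hr => hΩ x₀ r (by rw [natCoord_target]; exact ⟨hr.1, mem_univ _⟩) hr.2) hq
  have hps : p ∈ (natCoord x₀).source := mem_natCoord_source.2 (mem_chart_source E x₀)
  have hpt := (natCoord x₀).map_source hps
  have hp2 : natCoord x₀ p ∈ (extChartAt 𝓘(ℝ, E) x₀).target ×ˢ ({0}ᶜ : Set E) := by
    refine ⟨?_, (natCoord_symm_mem_slit hpt).1 ?_⟩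
    · rw [natCoord_target] at hpt
      exact hpt.1
    · rwa [(natCoord x₀).left_inv hps]
  -- The coordinate domain may be disconnected, so only openness of the level set of κ is used.
  have hopen := hF.isOpen_prod.isOpen_inter_preimage_of_fderiv_eq_zero (f := κ) (𝕜 := ℝ)
    (fun q hq => (hκ q hq).differentiableAt.differentiableWithinAt)
    (fun q hq => (hκ q hq).fderiv) {κ (natCoord x₀ p)}
  have hcont : ContinuousAt (natCoord x₀) p := continuousAt_extChartAt' hps
  have hsource : (natCoord x₀).source ∈ 𝓝 p := extChartAt_source_mem_nhds' hps
  filter_upwards [hcont (hopen.mem_nhds ⟨hp2, rfl⟩), hsource] with q hq hqs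
  have h := hq.2
  simp only [κ, mem_preimage, mem_singleton_iff, (natCoord x₀).left_inv hps,
    (natCoord x₀).left_inv hqs] at h
  exact h

end Manifold

end Finsler

end

theorem theorem1
    {E : Type*} [NormedAddCommGroup E] [NormedSpace ℝ E] [FiniteDimensional ℝ E]
    {M : Type*} [TopologicalSpace M] [ChartedSpace E M] [IsManifold 𝓘(ℝ, E) ∞ M]
    [ConnectedSpace M]
    (F : Finsler.FinslerStructure E M)
    (α β γ : ℝ) (hαβγ : α * γ - β ^ 2 ≠ 0)
    (V : ∀ x : M, TangentSpace 𝓘(ℝ, E) x)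
    (hV : ContMDiff 𝓘(ℝ, E) (𝓘(ℝ, E)).tangent ∞
      (fun x => (⟨x, V x⟩ : TangentBundle 𝓘(ℝ, E) M)))
    (Ω : TangentBundle 𝓘(ℝ, E) M → ℝ)
    (hΩ : Finsler.IsConformalCompleteLift F α β γ V Ω) :
    (Module.finrank ℝ E ≠ 1 → ∃ c : ℝ, ∀ p ∈ Finsler.slit E M, Ω p = c) ∧
      (∀ S ⊆ Finsler.slit E M, IsPreconnected S → ∃ c : ℝ, ∀ p ∈ S, Ω p = c) := by
  have hloc : ∀ p ∈ Finsler.slit E M, ∀ᶠ q in nhds p, Ω q = Ω p :=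
    fun p hp => hΩ.eventually_eq hαβγ hV hp
  refine ⟨fun hn => ?_, fun S hS hc => Finsler.exists_eq_const_of_isPreconnected hloc hS hc⟩
  rcases Nat.lt_or_gt_of_ne hn with h0 | h1
  -- Dimension 0: there are no non-zero vectors, so any constant works.
  · have : Subsingleton E := Module.finrank_zero_iff.1 (Nat.lt_one_iff.1 h0)
    exact ⟨0, fun p hp => (hp (Subsingleton.elim (α := E) _ _)).elim⟩
  · refine Finsler.exists_eq_const_of_one_lt_rank ?_ hloc
    rw [← Module.finrank_eq_rank]
    exact_mod_cast h1
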